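/- Let $\hbar\in\mathbb{C}$ with $\sinh\hbar\neq 0$. Let $\widetilde U(\mathfrak{sl}_2)_\hbar$ be the universal Arens–Michael algebra generated by $E,F,H$ subject to the relations $$[H,E]=2E,\qquad [H,F]=-2F,\qquad [E,F]=\frac{\sinh(\hbar H)}{\sinh\hbar},\qquad\text{where } \sinh(\hbar H)=\sum_{k\ge 0}\frac{\hbar^{2k+1}H^{2k+1}}{(2k+1)!}.$$ (An Arens–Michael algebra is a complete Hausdorff topological unital algebra over $\mathbb{C}$ whose topology is determined by a system of submultiplicative seminorms; "universal" means that for every Arens–Michael algebra $B$ and all elements of $B$ satisfying these relations there is a unique continuous unital homomorphism $\widetilde U(\mathfrak{sl}_2)_\hbar\to B$ sending $E,F,H$ to these elements.) Let $V$ be a complex Banach space and let $T$ be an irreducible continuous representation of $\widetilde U(\mathfrak{sl}_2)_\hbar$ on $V$; that is, $T$ is a continuous unital homomorphism from $\widetilde U(\mathfrak{sl}_2)_\hbar$ to the Banach algebra of bounded linear operators on $V$ with the operator norm, $V\neq 0$, and the only linear subspaces of $V$ (closed or not) that are invariant under $T(a)$ for all $a\in\widetilde U(\mathfrak{sl}_2)_\hbar$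 are $0$ and $V$. Then $V$ is finite dimensional. -/

import Mathlib

open Filter Topology

/-- An Arens-Michael algebra: a complete (Hausdorff) topological algebra over `ℂ` whose topology is
determined by a system of submultiplicative seminorms.  (Continuity of the multiplication and of the
scalar multiplication follows from the existence of such a system.) -/
structure IsArensMichael (A : Type*) [Ring A] [Algebra ℂ A] [UniformSpace A] [IsUniformAddGroup A] :
    Prop where
  complete : CompleteSpace A
  hausdorff : T2Space A
  seminorms : ∃ S : Set (Seminorm ℂ A), (∀ p ∈ S, ∀ x y, p (x * y) ≤ p x * p y) ∧
    WithSeminorms (fun p : S => (p : Seminorm ℂ A))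

/-- The relations `[H, E] = 2E`, `[H, F] = -2F`, `[E, F] = sinh(ħH) / sinh ħ` in a topological
algebra, where `sinh(ħH)` is the sum of the series `∑ ħ^(2k+1) H^(2k+1) / (2k+1)!`.
It is used for `sinh ħ ≠ 0` only. -/
structure QuantumSl2Relations (hbar : ℂ) {A : Type*} [Ring A] [Algebra ℂ A] [TopologicalSpace A]
    (E F H : A) : Prop where
  HE : H * E - E * H = (2 : ℂ) • E
  HF : H * F - F * H = (-2 : ℂ) • F
  EF : Tendsto (fun N : ℕ => (Complex.sinh hbar)⁻¹ • ∑ k ∈ Finset.range N,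
    (hbar ^ (2 * k + 1) / ((2 * k + 1).factorial : ℂ)) • H ^ (2 * k + 1)) atTop (𝓝 (E * F - F * E))

namespace QuantumSl2

/-- The names of the three generators. -/
inductive Gen
  | E
  | F
  | H

/-- The free associative unital algebra on three generators; it is given below a topology that
depends on `hbar`. -/
def Free (_hbar : ℂ) : Type := FreeAlgebra ℂ Gen

noncomputable instance (hbar : ℂ) : Ring (Free hbar) := inferInstanceAs (Ring (FreeAlgebra ℂ Gen))

noncomputable instance (hbar : ℂ) : Algebra ℂ (Free hbar) :=
  inferInstanceAs (Algebra ℂ (FreeAlgebra ℂ Gen))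

/-- A generator as an element of the free algebra. -/
noncomputable def gen (hbar : ℂ) (g : Gen) : Free hbar := FreeAlgebra.ι ℂ g

/-- The submultiplicative seminorms on the free algebra that are compatible with the relations:
those for which the relations hold in the associated (semi)normed algebra. -/
structure IsAdmissible {hbar : ℂ} (p : Seminorm ℂ (Free hbar)) : Prop where
  mul_le : ∀ x y, p (x * y) ≤ p x * p y
  HE : p (gen hbar .H * gen hbar .E - gen hbar .E * gen hbar .H - (2 : ℂ) • gen hbar .E) = 0
  HF : p (gen hbar .H * gen hbar .F - gen hbar .F * gen hbar .H - (-2 : ℂ) • gen hbar .F) = 0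
  EF : Tendsto (fun N : ℕ => p ((Complex.sinh hbar)⁻¹ • ∑ k ∈ Finset.range N,
      (hbar ^ (2 * k + 1) / ((2 * k + 1).factorial : ℂ)) • gen hbar .H ^ (2 * k + 1) -
      (gen hbar .E * gen hbar .F - gen hbar .F * gen hbar .E))) atTop (𝓝 0)

/-- The family of all admissible seminorms. -/
def seminorms (hbar : ℂ) :
    SeminormFamily ℂ (Free hbar) {p : Seminorm ℂ (Free hbar) // IsAdmissible p} :=
  fun p => p.1

/-- The free algebra is given the uniform structure determined by all admissible seminorms. -/
noncomputable instance (hbar : ℂ) : UniformSpace (Free hbar) :=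
  ⨅ p, (seminorms hbar p).toSeminormedAddCommGroup.toUniformSpace

instance (hbar : ℂ) : IsUniformAddGroup (Free hbar) :=
  isUniformAddGroup_iInf fun _ => inferInstance

theorem withSeminorms (hbar : ℂ) : WithSeminorms (seminorms hbar) :=
  (SeminormFamily.withSeminorms_iff_uniformSpace_eq_iInf _).2 rfl

end QuantumSl2

/-- A vector space topology given by submultiplicative seminorms makes the multiplication
continuous. -/
theorem isTopologicalRing_of_submultiplicative {A ι : Type*} [Ring A] [Algebra ℂ A]
    [TopologicalSpace A] [IsTopologicalAddGroup A] {P : SeminormFamily ℂ A ι}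
    (hP : WithSeminorms P) (hmul : ∀ i x y, P i (x * y) ≤ P i x * P i y) : IsTopologicalRing A := by
  have hnhds := P.withSeminorms_iff_nhds_eq_iInf.1 hP
  have hcont (i) : Tendsto (P i) (𝓝 0) (𝓝 0) := by
    simpa using (hP.continuous_seminorm i).tendsto 0
  apply IsTopologicalRing.of_addGroup_of_nhds_zero
  · rw [hnhds]
    simp only [tendsto_iInf, tendsto_comap_iff]
    rw [← hnhds]
    intro i
    have h0 : Tendsto (fun x : A × A => P i x.1 * P i x.2) (𝓝 0 ×ˢ 𝓝 0) (𝓝 0) := by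
      simpa using ((hcont i).comp tendsto_fst).mul ((hcont i).comp tendsto_snd)
    exact squeeze_zero (fun _ => apply_nonneg _ _) (fun x => hmul i x.1 x.2) h0
  · intro x
    rw [hnhds]
    simp only [tendsto_iInf, tendsto_comap_iff]
    rw [← hnhds]
    intro i
    have h0 : Tendsto (fun y : A => P i x * P i y) (𝓝 0) (𝓝 0) := by
      simpa using (hcont i).const_mul (P i x)
    exact squeeze_zero (fun _ => apply_nonneg _ _) (fun y => hmul i x y) h0
  · intro x
    rw [hnhds]
    simp only [tendsto_iInf, tendsto_comap_iff]
    rw [← hnhds]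
    intro i
    have h0 : Tendsto (fun y : A => P i y * P i x) (𝓝 0) (𝓝 0) := by
      simpa using (hcont i).mul_const (P i x)
    exact squeeze_zero (fun _ => apply_nonneg _ _) (fun y => hmul i y x) h0

namespace QuantumSl2

instance (hbar : ℂ) : IsTopologicalRing (Free hbar) :=
  isTopologicalRing_of_submultiplicative (withSeminorms hbar) fun i => i.2.mul_le

instance (hbar : ℂ) : ContinuousSMul ℂ (Free hbar) := (withSeminorms hbar).continuousSMul

instance (hbar : ℂ) : UniformContinuousConstSMul ℂ (Free hbar) :=
  uniformContinuousConstSMul_of_continuousConstSMul _ _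

end QuantumSl2

/-- The analytic form `Ũ(sl₂)_ħ`: the universal Arens-Michael algebra generated by `E`, `F`, `H`
subject to `[H, E] = 2E`, `[H, F] = -2F`, `[E, F] = sinh(ħH) / sinh ħ`, constructed as the Hausdorff
completion of the free algebra with respect to all submultiplicative seminorms compatible with the
relations.  The theorems `isArensMichael`, `relations` and `existsUnique_lift` below show that it
has the defining universal property. -/
abbrev AnalyticUsl2 (hbar : ℂ) : Type := UniformSpace.Completion (QuantumSl2.Free hbar)

namespace AnalyticUsl2

open QuantumSl2

/-- The generators of `Ũ(sl₂)_ħ`. -/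
noncomputable def gen (hbar : ℂ) (g : Gen) : AnalyticUsl2 hbar :=
  ((QuantumSl2.gen hbar g : Free hbar) : AnalyticUsl2 hbar)

theorem tendsto_free {hbar : ℂ} {α : Type*} {l : Filter α} {u : α → Free hbar} {y : Free hbar}
    (h : ∀ p : Seminorm ℂ (Free hbar), IsAdmissible p → Tendsto (fun a => p (u a - y)) l (𝓝 0)) :
    Tendsto u l (𝓝 y) := by
  refine ((withSeminorms hbar).tendsto_nhds u y).2 fun i ε hε => ?_
  exact (h i.1 i.2).eventually_lt_const hε

theorem coe_eq_of_seminorm_eq_zero {hbar : ℂ} {x y : Free hbar}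
    (h : ∀ p : Seminorm ℂ (Free hbar), IsAdmissible p → p (x - y) = 0) :
    (x : AnalyticUsl2 hbar) = y := by
  have hx : Tendsto (fun _ : ℕ => x) atTop (𝓝 y) := tendsto_free fun p hp => by
    simp [h p hp]
  exact tendsto_nhds_unique tendsto_const_nhds
    (((UniformSpace.Completion.continuous_coe (Free hbar)).tendsto y).comp hx)

theorem relations (hbar : ℂ) :
    QuantumSl2Relations hbar (gen hbar .E) (gen hbar .F) (gen hbar .H) where
  HE := by
    have := coe_eq_of_seminorm_eq_zero (hbar := hbar) fun p hp => IsAdmissible.HE hp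
    simpa only [UniformSpace.Completion.coe_sub, UniformSpace.Completion.coe_mul,
      UniformSpace.Completion.coe_smul, gen] using this
  HF := by
    have := coe_eq_of_seminorm_eq_zero (hbar := hbar) fun p hp => IsAdmissible.HF hp
    simpa only [UniformSpace.Completion.coe_sub, UniformSpace.Completion.coe_mul,
      UniformSpace.Completion.coe_smul, gen] using this
  EF := by
    have h1 := ((UniformSpace.Completion.continuous_coe (Free hbar)).tendsto _).comp
      (tendsto_free (hbar := hbar) fun p hp => IsAdmissible.EF hp)
    have h3 (x : Free hbar) (n : ℕ) : ((x ^ n : Free hbar) : AnalyticUsl2 hbar) =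
      (x : AnalyticUsl2 hbar) ^ n := map_pow UniformSpace.Completion.coeRingHom x n
    have h4 (N : ℕ) (f : ℕ → Free hbar) :
        ((∑ k ∈ Finset.range N, f k : Free hbar) : AnalyticUsl2 hbar) =
        ∑ k ∈ Finset.range N, (f k : AnalyticUsl2 hbar) :=
      map_sum UniformSpace.Completion.coeRingHom f _
    simpa only [Function.comp_def, UniformSpace.Completion.coe_sub, h3, h4,
      UniformSpace.Completion.coe_mul, UniformSpace.Completion.coe_smul, gen] using h1

theorem uniformContinuous_of_continuous {hbar : ℂ} (p : Seminorm ℂ (Free hbar))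
    (hp : Continuous p) : UniformContinuous p :=
  Seminorm.uniformContinuous_of_continuousAt_zero hp.continuousAt

/-- The extension of a continuous seminorm to the completion. -/
noncomputable def extend {hbar : ℂ} (p : Seminorm ℂ (Free hbar)) (hp : Continuous p) :
    Seminorm ℂ (AnalyticUsl2 hbar) :=
  have hu := uniformContinuous_of_continuous p hp
  have hc : Continuous (UniformSpace.Completion.extension p) :=
    UniformSpace.Completion.continuous_extension
  Seminorm.of (UniformSpace.Completion.extension p)
    (fun x y => by
      induction x, y using UniformSpace.Completion.induction_on₂ with
      | hp => exact isClosed_le (by fun_prop) (by fun_prop)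
      | ih x y =>
        rw [← UniformSpace.Completion.coe_add]
        simpa only [UniformSpace.Completion.extension_coe hu] using map_add_le_add p x y)
    (fun c x => by
      induction x using UniformSpace.Completion.induction_on with
      | hp => exact isClosed_eq (hc.comp (continuous_const_smul c)) (by fun_prop)
      | ih x =>
        rw [← UniformSpace.Completion.coe_smul]
        simpa only [UniformSpace.Completion.extension_coe hu] using map_smul_eq_mul p c x)

theorem continuous_extend {hbar : ℂ} (p : Seminorm ℂ (Free hbar)) (hp : Continuous p) :
    Continuous (extend p hp) :=
  UniformSpace.Completion.continuous_extension

theorem extend_coe {hbar : ℂ} (p : Seminorm ℂ (Free hbar)) (hp : Continuous p) (x : Free hbar) :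
    extend p hp (x : AnalyticUsl2 hbar) = p x :=
  UniformSpace.Completion.extension_coe (uniformContinuous_of_continuous p hp) x

theorem extend_mul_le {hbar : ℂ} (p : Seminorm ℂ (Free hbar)) (hp : Continuous p)
    (hmul : ∀ x y, p (x * y) ≤ p x * p y) (x y : AnalyticUsl2 hbar) :
    extend p hp (x * y) ≤ extend p hp x * extend p hp y := by
  have hc := continuous_extend p hp
  induction x, y using UniformSpace.Completion.induction_on₂ with
  | hp => exact isClosed_le (by fun_prop) (by fun_prop)
  | ih x y =>
    rw [← UniformSpace.Completion.coe_mul]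
    simpa only [extend_coe] using hmul x y

theorem isArensMichael (hbar : ℂ) : IsArensMichael (AnalyticUsl2 hbar) where
  complete := inferInstance
  hausdorff := inferInstance
  seminorms := by
    refine ⟨{p | Continuous p ∧ ∀ x y, p (x * y) ≤ p x * p y}, fun p hp => hp.2, ?_⟩
    rw [SeminormFamily.withSeminorms_iff_nhds_eq_iInf]
    apply le_antisymm
    · simp only [le_iInf_iff, ← tendsto_iff_comap]
      intro p
      simpa using p.2.1.tendsto 0
    · intro U hU
      obtain ⟨C, hC, hCcl, hCU⟩ := exists_mem_nhds_isClosed_subset hU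
      have hC' : {x : Free hbar | (x : AnalyticUsl2 hbar) ∈ C} ∈ 𝓝 (0 : Free hbar) :=
        (UniformSpace.Completion.continuous_coe (Free hbar)).tendsto 0
          (by rw [UniformSpace.Completion.coe_zero]; exact hC)
      obtain ⟨⟨s, r⟩, hr, hsr⟩ := (withSeminorms hbar).hasBasis_zero_ball.mem_iff.1 hC'
      have hcont (i : {p : Seminorm ℂ (Free hbar) // IsAdmissible p}) : Continuous i.1 :=
        (withSeminorms hbar).continuous_seminorm i
      let O : Set (AnalyticUsl2 hbar) := ⋂ i ∈ s, {x | extend i.1 (hcont i) x < r}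
      have hO : IsOpen O := isOpen_biInter_finset fun i _ =>
        isOpen_lt (continuous_extend i.1 (hcont i)) continuous_const
      have hOC : O ⊆ C := by
        have h1 := UniformSpace.Completion.denseRange_coe (α := Free hbar)
          |>.open_subset_closure_inter hO
        refine h1.trans (closure_minimal ?_ hCcl)
        rintro _ ⟨hx, x, rfl⟩
        refine hsr ?_
        rw [Seminorm.mem_ball_zero]
        refine Seminorm.finset_sup_apply_lt hr fun i hi => ?_
        have h2 : extend i.1 (hcont i) (x : AnalyticUsl2 hbar) < r := Set.mem_iInter₂.1 hx i hi
        rwa [extend_coe] at h2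
      refine mem_of_superset ?_ (hOC.trans hCU)
      refine (biInter_finset_mem s).2 fun i hi => ?_
      refine mem_iInf_of_mem ⟨extend i.1 (hcont i), continuous_extend _ _,
        extend_mul_le _ _ i.2.mul_le⟩ ?_
      refine ⟨Set.Iio r, Iio_mem_nhds hr, fun x hx => hx⟩

/-- The universal property. -/
theorem existsUnique_lift (hbar : ℂ) {B : Type*} [Ring B] [Algebra ℂ B] [UniformSpace B]
    [IsUniformAddGroup B] (hB : IsArensMichael B) {E F H : B}
    (h : QuantumSl2Relations hbar E F H) :
    ∃! φ : AnalyticUsl2 hbar →A[ℂ] B,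
      φ (gen hbar .E) = E ∧ φ (gen hbar .F) = F ∧ φ (gen hbar .H) = H := by
  have := hB.complete
  have := hB.hausdorff
  obtain ⟨S, hS, hSB⟩ := hB.seminorms
  have : IsTopologicalRing B := isTopologicalRing_of_submultiplicative hSB fun i => hS i.1 i.2
  let f : Free hbar →ₐ[ℂ] B := FreeAlgebra.lift ℂ (fun g : Gen => Gen.casesOn g E F H)
  have fE : f (QuantumSl2.gen hbar .E) = E := FreeAlgebra.lift_ι_apply _ _
  have fF : f (QuantumSl2.gen hbar .F) = F := FreeAlgebra.lift_ι_apply _ _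
  have fH : f (QuantumSl2.gen hbar .H) = H := FreeAlgebra.lift_ι_apply _ _
  have hadm (p : S) : IsAdmissible ((p : Seminorm ℂ B).comp f.toLinearMap) := by
    refine ⟨fun x y => ?_, ?_, ?_, ?_⟩
    · simpa using hS p p.2 (f x) (f y)
    · simp [fE, fH, h.HE]
    · simp [fF, fH, h.HF]
    · have h1 := ((hSB.continuous_seminorm p).tendsto 0).comp
        (tendsto_sub_nhds_zero_iff.2 h.EF)
      simpa [Function.comp_def, fE, fF, fH] using h1
  have hf : Continuous f := hSB.continuous_of_continuous_comp f.toLinearMap fun p =>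
    (withSeminorms hbar).continuous_seminorm ⟨_, hadm p⟩
  let φ : AnalyticUsl2 hbar →A[ℂ] B :=
    { UniformSpace.Completion.extensionHom (f : Free hbar →+* B) hf with
      commutes' := fun c => by
        have := UniformSpace.Completion.extensionHom_coe (f : Free hbar →+* B) hf
          (algebraMap ℂ (Free hbar) c)
        simpa [UniformSpace.Completion.algebraMap_def] using this
      cont := UniformSpace.Completion.continuous_extension }
  have hφ (x : Free hbar) : φ (x : AnalyticUsl2 hbar) = f x :=
    UniformSpace.Completion.extensionHom_coe (f : Free hbar →+* B) hf x
  refine ⟨φ, ⟨(hφ _).trans fE, (hφ _).trans fF, (hφ _).trans fH⟩, ?_⟩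
  rintro ψ ⟨hE, hF, hH⟩
  have key : ∀ x : Free hbar, ψ (x : AnalyticUsl2 hbar) = f x := by
    let c : Free hbar →ₐ[ℂ] AnalyticUsl2 hbar :=
      { UniformSpace.Completion.coeRingHom with commutes' := fun _ => rfl }
    have : (ψ : AnalyticUsl2 hbar →ₐ[ℂ] B).comp c = f := by
      refine FreeAlgebra.hom_ext (funext fun g => ?_)
      cases g
      · exact hE.trans fE.symm
      · exact hF.trans fF.symm
      · exact hH.trans fH.symm
    exact fun x => DFunLike.congr_fun this x
  refine ContinuousAlgHom.ext fun x => ?_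
  induction x using UniformSpace.Completion.induction_on with
  | hp => exact isClosed_eq ψ.cont φ.cont
  | ih x => rw [key, hφ]

end AnalyticUsl2

/-- A continuous representation of `Ũ(sl₂)_ħ` on a Banach space `V`, that is, a continuous unital
homomorphism to the Banach algebra of bounded operators with the operator norm, is irreducible if
`V ≠ 0` and there is no invariant linear subspace, closed or not, other than `0` and `V`. -/
def AnalyticUsl2.IsIrreducible {hbar : ℂ} {V : Type*} [NormedAddCommGroup V] [NormedSpace ℂ V]
    (T : AnalyticUsl2 hbar →A[ℂ] (V →L[ℂ] V)) : Prop :=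
  Nontrivial V ∧ ∀ W : Submodule ℂ V, (∀ a, ∀ v ∈ W, T a v ∈ W) → W = ⊥ ∨ W = ⊤

/-! The argument is the highest weight argument for `sl₂`, with analysis supplying an eigenvector of
`H`. Put `q = exp ħ`. The quantum Casimir `FE + (q exp(ħH) + q⁻¹ exp(-ħH)) / (2 sinh ħ)²` commutes
with the representation, so it is a scalar by Schur's lemma. The relation `[H, E] = 2E` between
bounded operators makes `E` nilpotent, so `ker E` is a nonzero closed `H`-invariant subspace. There
the Casimir loses its term `FE`, so a combination of `exp(ħH)` and `exp(-ħH)` is scalar.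

Such an identity forces an eigenvector (`exists_eigenvector_of_exp_add_exp_neg`): for `μ` in the
spectrum, if `H - μ` were injective on `ker E`, comparing Taylor coefficients at `μ` up to order two
would make the combination trivial. The eigenvector is a highest weight vector `v`. As `F` is
nilpotent too, the `Fⁱ v` span a finite-dimensional invariant subspace, which is all of `V`. -/

section Exponential

/-! ### Exponentials in a Banach algebra. -/

variable {A : Type*} [NormedRing A] [NormedAlgebra ℂ A] [CompleteSpace A]

theorem exp_add_smul_one (x : A) (μ : ℂ) :
    NormedSpace.exp (x + μ • (1 : A)) = Complex.exp μ • NormedSpace.exp x := by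
  let _ : NormedAlgebra ℚ A := NormedAlgebra.restrictScalars ℚ ℂ A
  have h : Commute x (μ • (1 : A)) := (Commute.one_right x).smul_right μ
  rw [NormedSpace.exp_add_of_commute h, ← Algebra.algebraMap_eq_smul_one,
    ← NormedSpace.algebraMap_exp_comm (𝕂 := ℂ), ← Complex.exp_eq_exp_ℂ,
    Algebra.algebraMap_eq_smul_one, mul_smul_comm, mul_one]

/-- The exponential as a second order Taylor polynomial plus a remainder. -/
theorem exists_exp_eq_taylor (x : A) : ∃ W : A, Commute x W ∧
    NormedSpace.exp x = 1 + x + (2⁻¹ : ℂ) • x ^ 2 + x ^ 3 * W := by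
  have hs : Summable fun n : ℕ => (((n + 3).factorial : ℂ)⁻¹) • x ^ n := by
    refine (NormedSpace.norm_expSeries_summable' (𝕂 := ℂ) x).of_norm_bounded fun n => ?_
    rw [norm_smul, norm_smul]
    gcongr
    rw [norm_inv, norm_inv, Complex.norm_natCast, Complex.norm_natCast]
    gcongr
    omega
  refine ⟨∑' n : ℕ, (((n + 3).factorial : ℂ)⁻¹) • x ^ n,
    Commute.tsum_right x fun n => ((Commute.refl x).pow_right n).smul_right _, ?_⟩
  rw [← hs.tsum_mul_left, NormedSpace.exp_eq_tsum ℂ]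
  have hexp := NormedSpace.expSeries_summable' (𝕂 := ℂ) x
  beta_reduce
  rw [← hexp.sum_add_tsum_nat_add 3]
  congr 1
  · simp [Finset.sum_range_succ, Nat.factorial]
  · exact tsum_congr fun n => by rw [mul_smul_comm, ← pow_add, add_comm 3 n]

theorem tendsto_sum_odd_exp (z : ℂ) (x : A) :
    Tendsto (fun N : ℕ => ∑ k ∈ Finset.range N,
      (z ^ (2 * k + 1) / ((2 * k + 1).factorial : ℂ)) • x ^ (2 * k + 1)) atTop
      (𝓝 ((2⁻¹ : ℂ) • (NormedSpace.exp (z • x) - NormedSpace.exp (-(z • x))))) := by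
  have h := (((NormedSpace.exp_series_hasSum_exp' (𝕂 := ℂ) (z • x)).sub
    (NormedSpace.exp_series_hasSum_exp' (𝕂 := ℂ) (-(z • x)))).const_smul (2⁻¹ : ℂ)).tendsto_sum_nat
  -- Passing to partial sums of length `2N` pairs each even term with the next odd one: the even
  -- terms cancel and the odd ones double.
  have h2 := h.comp (tendsto_id.const_mul_atTop' (show 0 < 2 by norm_num))
  refine h2.congr fun N => ?_
  simp only [Function.comp_apply, id]
  induction N with
  | zero => simp
  | succ N ih =>
    rw [show 2 * (N + 1) = 2 * N + 1 + 1 by ring, Finset.sum_range_succ, Finset.sum_range_succ, ih,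
      Finset.sum_range_succ]
    have h1 : (-(z • x)) ^ (2 * N) = (z • x) ^ (2 * N) := Even.neg_pow (even_two_mul N) _
    have h2 : (-(z • x)) ^ (2 * N + 1) = -(z • x) ^ (2 * N + 1) :=
      Odd.neg_pow (odd_two_mul_add_one N) _
    rw [h1, h2, sub_self, smul_zero, add_zero, smul_pow]
    congr 1
    module

/-- If a combination `a exp x + b exp (-x)` with `a ≠ 0` is a scalar, and `x` is left
regular, then `x` is invertible. -/
theorem isUnit_of_exp_add_exp_neg_eq {x : A} {a b m : ℂ} (ha : a ≠ 0)
    (h : a • NormedSpace.exp x + b • NormedSpace.exp (-x) = m • (1 : A))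
    (hx : ∀ y, x * y = 0 → y = 0) : IsUnit x := by
  obtain ⟨W, hW, hWe⟩ := exists_exp_eq_taylor x
  obtain ⟨W', hW', hWe'⟩ := exists_exp_eq_taylor (-x)
  by_contra hu
  have hW'' : Commute x W' := by simpa using hW'.neg_left
  -- Peeling off one coefficient: `c ≠ 0` would invert `x`, so `c = 0`, and then left regularity
  -- cancels `x`.
  have key (c : ℂ) (y : A) (hy : Commute x y) (h0 : c • (1 : A) + x * y = 0) : c = 0 ∧ y = 0 := by
    have hc : c = 0 := by
      by_contra hc
      have h1 : x * ((-c⁻¹) • y) = 1 := by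
        rw [mul_smul_comm, eq_neg_of_add_eq_zero_right h0, smul_neg, neg_smul, neg_neg, smul_smul,
          inv_mul_cancel₀ hc, one_smul]
      exact hu ⟨⟨x, (-c⁻¹) • y, h1, by rw [← (hy.smul_right (-c⁻¹)).eq, h1]⟩, rfl⟩
    refine ⟨hc, hx y ?_⟩
    simpa [hc] using h0
  have hR : Commute x (a • W - b • W') := (hW.smul_right a).sub_right (hW''.smul_right b)
  -- The Taylor expansion in Horner form, so that `key` can be applied repeatedly; the coefficients
  -- of orders one and two give `a - b = 0` and `a + b = 0`.
  have e0 : (a + b - m) • (1 : A) + x * ((a - b) • (1 : A) +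
      x * ((2⁻¹ * (a + b)) • (1 : A) + x * (a • W - b • W'))) = 0 := by
    rw [hWe, hWe', ← sub_eq_zero] at h
    rw [← h]
    have h3 : (-x) ^ 3 = -(x ^ 3) := Odd.neg_pow (by decide) x
    have h2 : (-x) ^ 2 = x ^ 2 := neg_sq x
    rw [h3, h2]
    simp only [mul_add, mul_sub, mul_smul_comm, mul_one, pow_succ, pow_zero, one_mul, mul_assoc,
      neg_mul]
    module
  have c1 (c : ℂ) : Commute x (c • (1 : A)) := (Commute.one_right x).smul_right c
  have r2 := (c1 (2⁻¹ * (a + b))).add_right ((Commute.refl x).mul_right hR)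
  have r1 := (c1 (a - b)).add_right ((Commute.refl x).mul_right r2)
  obtain ⟨-, e1⟩ := key _ _ r1 e0
  obtain ⟨f1, e2⟩ := key _ _ r2 e1
  obtain ⟨f2, -⟩ := key _ _ hR e2
  apply ha
  linear_combination f2 + f1 / 2

end Exponential

/-! ### Intertwiners, weights and nilpotency. -/

section Operators

variable {X Y : Type*} [NormedAddCommGroup X] [NormedSpace ℂ X] [CompleteSpace X]
  [NormedAddCommGroup Y] [NormedSpace ℂ Y] [CompleteSpace Y]

/-- Intertwining passes to powers and then to convergent series. Two spaces are allowed so that `S`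
can also be the inclusion of `ker E`. -/
theorem comp_exp_of_intertwine {S : X →L[ℂ] Y} {A : X →L[ℂ] X} {B : Y →L[ℂ] Y}
    (h : S ∘SL A = B ∘SL S) : S ∘SL NormedSpace.exp A = NormedSpace.exp B ∘SL S := by
  have hpow (n : ℕ) : S ∘SL (A ^ n) = (B ^ n) ∘SL S := by
    induction n with
    | zero => ext; simp
    | succ n ih =>
      ext v
      have h1 := DFunLike.congr_fun ih (A v)
      have h2 := DFunLike.congr_fun h v
      simp only [ContinuousLinearMap.comp_apply] at h1 h2 ⊢
      rw [pow_succ, pow_succ, mul_apply_eq_comp, mul_apply_eq_comp, h1, h2]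
  have hA := (NormedSpace.exp_series_hasSum_exp' (𝕂 := ℂ) A).mapL
    ((ContinuousLinearMap.compL ℂ X X Y) S)
  have hB := (NormedSpace.exp_series_hasSum_exp' (𝕂 := ℂ) B).mapL
    ((ContinuousLinearMap.compL ℂ X Y Y).flip S)
  refine hA.unique (hB.congr_fun fun n => ?_)
  simp [hpow]

/-- If `[H, X] = c X` with `c ≠ 0` in a normed algebra, then `X` is nilpotent. -/
theorem isNilpotent_of_commutator_eq_smul {A : Type*} [NormedRing A] [NormedAlgebra ℂ A] {H X : A}
    {c : ℂ} (hc : c ≠ 0) (h : H * X - X * H = c • X) : IsNilpotent X := by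
  have hpow (n : ℕ) : H * X ^ n - X ^ n * H = (n * c) • X ^ n := by
    induction n with
    | zero => simp
    | succ n ih =>
      have : H * X ^ (n + 1) - X ^ (n + 1) * H =
          (H * X ^ n - X ^ n * H) * X + X ^ n * (H * X - X * H) := by
        rw [pow_succ]; noncomm_ring
      rw [this, ih, h, smul_mul_assoc, mul_smul_comm, ← pow_succ, ← add_smul]
      push_cast
      ring_nf
  -- By `hpow`, `n‖c‖ ‖Xⁿ‖ ≤ 2‖H‖ ‖Xⁿ‖`, which forces `Xⁿ = 0` for this `n`.
  obtain ⟨n, hn⟩ := exists_nat_gt (2 * ‖H‖ / ‖c‖)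
  refine ⟨n, ?_⟩
  by_contra hX
  have hX' : 0 < ‖X ^ n‖ := norm_pos_iff.2 hX
  have hc' : 0 < ‖c‖ := norm_pos_iff.2 hc
  rw [div_lt_iff₀ hc'] at hn
  have h1 : n * ‖c‖ * ‖X ^ n‖ ≤ 2 * ‖H‖ * ‖X ^ n‖ := by
    calc n * ‖c‖ * ‖X ^ n‖ = ‖H * X ^ n - X ^ n * H‖ := by
          rw [hpow, norm_smul, norm_mul, Complex.norm_natCast]
      _ ≤ ‖H * X ^ n‖ + ‖X ^ n * H‖ := norm_sub_le _ _
      _ ≤ ‖H‖ * ‖X ^ n‖ + ‖X ^ n‖ * ‖H‖ := add_le_add (norm_mul_le _ _) (norm_mul_le _ _)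
      _ = 2 * ‖H‖ * ‖X ^ n‖ := by ring
  exact absurd (le_of_mul_le_mul_right h1 hX') (not_le.2 hn)

end Operators

/-- The quantum Casimir element commutes with `E` and `F`, where `P` and `M` play the roles of
`exp (ħH)` and `exp (-ħH)`. -/
theorem commute_quantum_casimir {A : Type*} [Ring A] [Algebra ℂ A] {E F P M : A} {q r κ : ℂ}
    (hqr : q * r = 1) (hEF : E * F - F * E = (κ * (q - r)) • (P - M))
    (hEP : E * P = r ^ 2 • (P * E)) (hEM : E * M = q ^ 2 • (M * E))
    (hFP : F * P = q ^ 2 • (P * F)) (hFM : F * M = r ^ 2 • (M * F)) :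
    Commute (F * E + κ • (q • P + r • M)) E ∧ Commute (F * E + κ • (q • P + r • M)) F := by
  constructor
  · have h : E * (F * E + κ • (q • P + r • M)) - (F * E + κ • (q • P + r • M)) * E =
        (E * F - F * E) * E + κ • (q • (E * P) + r • (E * M) - q • (P * E) - r • (M * E)) := by
      simp only [mul_add, add_mul, sub_mul, mul_smul_comm, smul_mul_assoc, mul_assoc]
      module
    refine Eq.symm (sub_eq_zero.1 (h.trans ?_))
    rw [hEF, hEP, hEM, smul_mul_assoc, sub_mul]
    -- The coefficients of `PE` and `ME` vanish because `q r² = r` and `r q² = q`.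
    match_scalars
    · linear_combination κ * r * hqr
    · linear_combination κ * q * hqr
  · have h : (F * E + κ • (q • P + r • M)) * F - F * (F * E + κ • (q • P + r • M)) =
        F * (E * F - F * E) + κ • (q • (P * F) + r • (M * F) - q • (F * P) - r • (F * M)) := by
      simp only [mul_add, add_mul, mul_sub, mul_smul_comm, smul_mul_assoc, mul_assoc]
      module
    refine sub_eq_zero.1 (h.trans ?_)
    rw [hEF, mul_smul_comm, mul_sub F, hFP, hFM]
    match_scalars
    · linear_combination -κ * q * hqr
    · linear_combination -κ * r * hqr

section Operators

variable {V : Type*} [NormedAddCommGroup V] [NormedSpace ℂ V] [CompleteSpace V]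

/-- `X` intertwines `zH` with `zH - zc`, and the scalar shift comes out of the exponential as a
factor. -/
theorem mul_exp_of_commutator_eq_smul {H X : V →L[ℂ] V} {c : ℂ} (h : H * X - X * H = c • X)
    (z : ℂ) : X * NormedSpace.exp (z • H) =
      Complex.exp (-(z * c)) • (NormedSpace.exp (z • H) * X) := by
  have h1 : X ∘SL (z • H) = (z • H + (-(z * c)) • (1 : V →L[ℂ] V)) ∘SL X := by
    change X * (z • H) = (z • H + (-(z * c)) • (1 : V →L[ℂ] V)) * X
    rw [add_mul, mul_smul_comm, smul_mul_assoc, smul_mul_assoc, one_mul,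
      show X * H = H * X - c • X by rw [← h]; abel]
    module
  have h2 := comp_exp_of_intertwine h1
  rw [exp_add_smul_one] at h2
  rw [← smul_mul_assoc]
  exact h2

/-- An operator `h` for which a nontrivial combination of `exp (z h)` and `exp (-z h)` is scalar has
an eigenvector. -/
theorem exists_eigenvector_of_exp_add_exp_neg [Nontrivial V] {h : V →L[ℂ] V} {z a b m : ℂ}
    (hz : z ≠ 0) (ha : a ≠ 0)
    (hab : a • NormedSpace.exp (z • h) + b • NormedSpace.exp (-(z • h)) = m • (1 : V →L[ℂ] V)) :
    ∃ v : V, v ≠ 0 ∧ ∃ μ : ℂ, h v = μ • v := by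
  obtain ⟨μ, hμ⟩ := spectrum.nonempty h
  by_contra! hno
  -- `D` is not invertible, since `μ` is in the spectrum, but is injective if there are no
  -- eigenvectors. Centring at `μ` only multiplies `a` and `b` by nonzero factors.
  set D : V →L[ℂ] V := z • (h - μ • (1 : V →L[ℂ] V)) with hD
  have hinj (v : V) (hv : D v = 0) : v = 0 := by
    by_contra hv0
    refine hno v hv0 μ ?_
    have : z • (h v - μ • v) = 0 := by simpa [hD] using hv
    exact sub_eq_zero.1 ((smul_eq_zero.1 this).resolve_left hz)
  have h1 : z • h = D + (z * μ) • (1 : V →L[ℂ] V) := by rw [hD]; module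
  have h2 : -(z • h) = -D + (-(z * μ)) • (1 : V →L[ℂ] V) := by rw [hD]; module
  rw [h2, h1, exp_add_smul_one, exp_add_smul_one, smul_smul, smul_smul] at hab
  have hu : IsUnit D := by
    refine isUnit_of_exp_add_exp_neg_eq (mul_ne_zero ha (Complex.exp_ne_zero _)) hab
      fun y hy => ?_
    ext v
    exact hinj _ (DFunLike.congr_fun hy v)
  apply hμ
  have h3 : algebraMap ℂ (V →L[ℂ] V) μ - h = (-z⁻¹) • D := by
    rw [Algebra.algebraMap_eq_smul_one, hD, smul_smul, neg_mul, inv_mul_cancel₀ hz]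
    module
  rw [spectrum.mem_resolventSet_iff, h3]
  exact (isUnit_smul_iff (Units.mk0 (-z⁻¹) (by simpa using hz)) D).2 hu

end Operators

theorem QuantumSl2Relations.EF_eq {hbar : ℂ} {A : Type*} [NormedRing A] [NormedAlgebra ℂ A]
    [CompleteSpace A] {E F H : A} (h : QuantumSl2Relations hbar E F H) :
    E * F - F * E = (2 * Complex.sinh hbar)⁻¹ •
      (NormedSpace.exp (hbar • H) - NormedSpace.exp (-(hbar • H))) := by
  have := tendsto_nhds_unique h.EF ((tendsto_sum_odd_exp hbar H).const_smul (Complex.sinh hbar)⁻¹)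
  rw [this, smul_smul, mul_inv_rev]

/-! ### The Casimir operator and highest weight vectors. -/

namespace QuantumSl2Relations

variable {hbar : ℂ} {V : Type*} [NormedAddCommGroup V] [NormedSpace ℂ V]
  {E F H : V →L[ℂ] V}

/-- The Casimir operator is central. -/
theorem commute_casimir [CompleteSpace V] (h : QuantumSl2Relations hbar E F H)
    (hs : Complex.sinh hbar ≠ 0) {C : V →L[ℂ] V} (hC : C = F * E + (2 * Complex.sinh hbar)⁻¹ ^ 2 •
      (Complex.exp hbar • NormedSpace.exp (hbar • H) +
        Complex.exp (-hbar) • NormedSpace.exp (-(hbar • H)))) :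
    Commute C E ∧ Commute C F ∧ Commute C H := by
  have hEP := mul_exp_of_commutator_eq_smul h.HE hbar
  have hEM := mul_exp_of_commutator_eq_smul h.HE (-hbar)
  have hFP := mul_exp_of_commutator_eq_smul h.HF hbar
  have hFM := mul_exp_of_commutator_eq_smul h.HF (-hbar)
  have e1 : Complex.exp (-(hbar * 2)) = Complex.exp (-hbar) ^ 2 := by
    rw [← Complex.exp_nat_mul]; congr 1; push_cast; ring
  have e2 : Complex.exp (hbar * 2) = Complex.exp hbar ^ 2 := by
    rw [← Complex.exp_nat_mul]; congr 1; push_cast; ring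
  simp only [neg_smul, neg_mul, mul_neg, neg_neg, e1, e2] at hEP hEM hFP hFM
  have hqr : Complex.exp hbar * Complex.exp (-hbar) = 1 := by
    rw [← Complex.exp_add, add_neg_cancel, Complex.exp_zero]
  have hEF := h.EF_eq
  have hsinh : Complex.exp hbar - Complex.exp (-hbar) = 2 * Complex.sinh hbar := by
    rw [Complex.two_sinh]
  -- Matches `commute_quantum_casimir` with `κ = (2 sinh ħ)⁻²`, as `q - r = 2 sinh ħ`.
  have hκ : (2 * Complex.sinh hbar)⁻¹ =
      (2 * Complex.sinh hbar)⁻¹ ^ 2 * (Complex.exp hbar - Complex.exp (-hbar)) := by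
    rw [hsinh]; field_simp
  rw [hκ] at hEF
  obtain ⟨h1, h2⟩ := commute_quantum_casimir hqr hEF hEP hEM hFP hFM
  rw [hC]
  refine ⟨h1, h2, ?_⟩
  have hP : Commute (hbar • H) H := (Commute.refl H).smul_left hbar
  have hFE : Commute (F * E) H := by
    have h3 : F * E * H - H * (F * E) = -(F * (H * E - E * H)) - (H * F - F * H) * E := by
      noncomm_ring
    refine sub_eq_zero.1 (h3.trans ?_)
    rw [h.HE, h.HF, mul_smul_comm, smul_mul_assoc]
    module
  exact hFE.add_left (((hP.exp_left.smul_left _).add_left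
    (hP.neg_left.exp_left.smul_left _)).smul_left _)

/-- If the Casimir operator is scalar, then on a nonzero subspace annihilated by `E` (given here by
its inclusion `S`) the operator `H` has an eigenvector. -/
theorem exists_eigenvector_of_casimir_eq_smul_one [CompleteSpace V] {X : Type*}
    [NormedAddCommGroup X] [NormedSpace ℂ X] [CompleteSpace X] [Nontrivial X]
    (hs : Complex.sinh hbar ≠ 0) {c : ℂ}
    (hc : F * E + (2 * Complex.sinh hbar)⁻¹ ^ 2 •
      (Complex.exp hbar • NormedSpace.exp (hbar • H) +
        Complex.exp (-hbar) • NormedSpace.exp (-(hbar • H))) = c • (1 : V →L[ℂ] V))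
    {S : X →L[ℂ] V} (hS : Function.Injective S) (hES : ∀ x, E (S x) = 0) {η : X →L[ℂ] X}
    (hη : ∀ x, S (η x) = H (S x)) : ∃ x : X, x ≠ 0 ∧ ∃ μ : ℂ, η x = μ • x := by
  have hz : hbar ≠ 0 := by rintro rfl; simp at hs
  have hexp (z : ℂ) (x : X) : S (NormedSpace.exp (z • η) x) = NormedSpace.exp (z • H) (S x) := by
    have h1 : S ∘SL (z • η) = (z • H) ∘SL S := by ext x; simp [hη]
    exact DFunLike.congr_fun (comp_exp_of_intertwine h1) x
  -- On the image of `S` the term `FE` vanishes; multiplying the rest of the Casimir by `(2 sinh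
  -- ħ)²` gives this `m`.
  refine exists_eigenvector_of_exp_add_exp_neg (a := Complex.exp hbar) (b := Complex.exp (-hbar))
    (m := (2 * Complex.sinh hbar) ^ 2 * c) hz (Complex.exp_ne_zero _) ?_
  ext x
  have h1 := DFunLike.congr_fun hc (S x)
  have h2 := hexp hbar x
  have h3 := hexp (-hbar) x
  simp only [neg_smul] at h3
  apply hS
  simp only [add_apply, mul_apply_eq_comp, hES, map_zero, zero_add, map_add, map_smul,
    smul_apply, one_apply_eq_self, h2, h3] at h1 ⊢
  rw [mul_smul, ← h1, smul_smul, ← mul_pow, mul_inv_cancel₀ (mul_ne_zero two_ne_zero hs), one_pow,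
    one_smul]

/-- If the Casimir operator is scalar, there is a highest weight vector. -/
theorem exists_highestWeight [CompleteSpace V] [Nontrivial V] (h : QuantumSl2Relations hbar E F H)
    (hs : Complex.sinh hbar ≠ 0) {c : ℂ} (hc : F * E + (2 * Complex.sinh hbar)⁻¹ ^ 2 •
      (Complex.exp hbar • NormedSpace.exp (hbar • H) +
        Complex.exp (-hbar) • NormedSpace.exp (-(hbar • H))) = c • (1 : V →L[ℂ] V)) :
    ∃ v : V, v ≠ 0 ∧ E v = 0 ∧ ∃ μ : ℂ, H v = μ • v := by
  obtain ⟨n, hn⟩ := isNilpotent_of_commutator_eq_smul two_ne_zero h.HE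
  have hKcl : IsClosed (E.ker : Set V) := E.isClosed_ker
  have : CompleteSpace E.ker := hKcl.completeSpace_coe
  -- A nilpotent operator on a nonzero space is not injective.
  have : Nontrivial E.ker := by
    rw [Submodule.nontrivial_iff_ne_bot]
    intro hbot
    have hinj : Function.Injective E := LinearMap.ker_eq_bot.1 hbot
    have hpow (k : ℕ) : Function.Injective (E ^ k) := by
      induction k with
      | zero => exact Function.injective_id
      | succ k ih => rw [pow_succ]; exact ih.comp hinj
    obtain ⟨v, hv⟩ := exists_ne (0 : V)
    exact hv (hpow n (by rw [hn]; simp))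
  have hHK : ∀ v ∈ E.ker, H v ∈ E.ker := by
    intro v hv
    have h1 := DFunLike.congr_fun h.HE v
    change E v = 0 at hv
    change E (H v) = 0
    simpa [hv] using h1
  obtain ⟨v, hv, μ, hμ⟩ := exists_eigenvector_of_casimir_eq_smul_one (η := H.restrict hHK) hs hc
    (S := E.ker.subtypeL) Subtype.val_injective (fun v => v.2) fun _ => rfl
  exact ⟨v, by simpa using hv, v.2, μ, congrArg Subtype.val hμ⟩

/-- A highest weight vector lies in a finite-dimensional invariant subspace. -/
theorem exists_invariant_finiteDimensional (h : QuantumSl2Relations hbar E F H) {v : V}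
    (hE : E v = 0) {μ : ℂ} (hμ : H v = μ • v) :
    ∃ W : Submodule ℂ V, v ∈ W ∧ FiniteDimensional ℂ W ∧ (∀ w ∈ W, E w ∈ W) ∧
      (∀ w ∈ W, F w ∈ W) ∧ ∀ w ∈ W, H w ∈ W := by
  obtain ⟨n, hn⟩ := isNilpotent_of_commutator_eq_smul (neg_ne_zero.2 two_ne_zero) h.HF
  let W : Submodule ℂ V := Submodule.span ℂ (Set.range fun i : ℕ => (F ^ i) v)
  have hmem (i : ℕ) : (F ^ i) v ∈ W := Submodule.subset_span ⟨i, rfl⟩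
  have hsucc (i : ℕ) : (F ^ (i + 1)) v = F ((F ^ i) v) := by rw [pow_succ']; rfl
  have hinv (X : V →L[ℂ] V) (hX : ∀ i, X ((F ^ i) v) ∈ W) : ∀ w ∈ W, X w ∈ W := by
    intro w hw
    have : W ≤ W.comap (X : V →ₗ[ℂ] V) := by
      rw [Submodule.span_le]
      rintro _ ⟨i, rfl⟩
      exact hX i
    exact this hw
  have hfin : FiniteDimensional ℂ W := by
    refine FiniteDimensional.span_of_finite ℂ
      (((Set.finite_Iio n).image fun i => (F ^ i) v).union (Set.finite_singleton 0) |>.subset ?_)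
    rintro _ ⟨i, rfl⟩
    rcases lt_or_ge i n with hi | hi
    · exact Or.inl ⟨i, hi, rfl⟩
    · right
      simp [pow_eq_zero_of_le hi hn]
  have hFW : ∀ w ∈ W, F w ∈ W := hinv F fun i => hsucc i ▸ hmem (i + 1)
  have hHW : ∀ w ∈ W, H w ∈ W := by
    refine hinv H fun i => ?_
    induction i with
    | zero => simpa [hμ] using W.smul_mem μ (hmem 0)
    | succ i ih =>
      have h1 := DFunLike.congr_fun h.HF ((F ^ i) v)
      have h2 : H (F ((F ^ i) v)) = F (H ((F ^ i) v)) + (-2 : ℂ) • F ((F ^ i) v) := by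
        rw [← sub_eq_iff_eq_add']; exact h1
      rw [hsucc, h2]
      exact W.add_mem (hFW _ ih) (W.smul_mem _ (hFW _ (hmem i)))
  have hpow (k : ℕ) : ∀ w ∈ W, (H ^ k) w ∈ W := by
    induction k with
    | zero => simp
    | succ k ih => exact fun w hw => by rw [pow_succ]; exact ih _ (hHW w hw)
  -- `[E, F] w` is a limit of polynomials in `H` applied to `w`, and `W` is closed, being finite
  -- dimensional.
  have hcomm : ∀ w ∈ W, (E * F - F * E) w ∈ W := by
    intro w hw
    have h1 := ((ContinuousLinearMap.apply ℂ V w).continuous.tendsto _).comp h.EF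
    refine W.closed_of_finiteDimensional.mem_of_tendsto h1 (Eventually.of_forall fun N => ?_)
    simp only [Function.comp_apply, ContinuousLinearMap.apply_apply, smul_apply,
      sum_apply]
    exact W.smul_mem _ (W.sum_mem fun k _ => W.smul_mem _ (hpow _ w hw))
  refine ⟨W, by simpa using hmem 0, hfin, hinv E fun i => ?_, hFW, hHW⟩
  induction i with
  | zero => simp [hE]
  | succ i ih =>
    have h2 : E (F ((F ^ i) v)) = F (E ((F ^ i) v)) + (E * F - F * E) ((F ^ i) v) := by
      simp
    rw [hsucc, h2]
    exact W.add_mem (hFW _ ih) (hcomm _ (hmem i))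

end QuantumSl2Relations

/-! ### From generators to the whole algebra; Schur's lemma. -/

namespace AnalyticUsl2

open QuantumSl2

/-- A closed subalgebra of the target that contains the images of the generators contains the
image of every element. -/
theorem map_mem_of_gen_mem {hbar : ℂ} {B : Type*} [Ring B] [Algebra ℂ B] [TopologicalSpace B]
    (T : AnalyticUsl2 hbar →A[ℂ] B) (S : Subalgebra ℂ B) (hS : IsClosed (S : Set B))
    (hgen : ∀ g, T (gen hbar g) ∈ S) (a : AnalyticUsl2 hbar) : T a ∈ S := by
  induction a using UniformSpace.Completion.induction_on with
  | hp => exact hS.preimage T.cont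
  | ih x =>
    let c : FreeAlgebra ℂ Gen →ₐ[ℂ] AnalyticUsl2 hbar :=
      { (UniformSpace.Completion.coeRingHom : Free hbar →+* AnalyticUsl2 hbar) with
        commutes' := fun _ => rfl }
    change T (c x) ∈ S
    induction x using FreeAlgebra.induction with
    | grade0 r => exact (AlgHomClass.commutes T r).symm ▸ S.algebraMap_mem r
    | grade1 g => exact hgen g
    | mul x y hx hy => rw [map_mul, map_mul]; exact S.mul_mem hx hy
    | add x y hx hy => rw [map_add, map_add]; exact S.add_mem hx hy

variable {hbar : ℂ} {V : Type*} [NormedAddCommGroup V] [NormedSpace ℂ V]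

theorem relations_map (T : AnalyticUsl2 hbar →A[ℂ] (V →L[ℂ] V)) :
    QuantumSl2Relations hbar (T (gen hbar .E)) (T (gen hbar .F)) (T (gen hbar .H)) where
  HE := by simpa using congrArg T (relations hbar).HE
  HF := by simpa using congrArg T (relations hbar).HF
  EF := by simpa [Function.comp_def] using (T.cont.tendsto _).comp (relations hbar).EF

theorem commute_map_of_gen (T : AnalyticUsl2 hbar →A[ℂ] (V →L[ℂ] V)) {C : V →L[ℂ] V}
    (hC : ∀ g, Commute C (T (gen hbar g))) (a : AnalyticUsl2 hbar) : Commute C (T a) := by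
  have hcl : IsClosed (Subalgebra.centralizer ℂ {C} : Set (V →L[ℂ] V)) := Set.isClosed_centralizer _
  have := map_mem_of_gen_mem T (Subalgebra.centralizer ℂ {C}) hcl
    (fun g => Subalgebra.mem_centralizer_iff ℂ |>.2 (by rintro _ rfl; exact hC g)) a
  exact Subalgebra.mem_centralizer_iff ℂ |>.1 this C rfl

theorem map_mem_of_gen_invariant (T : AnalyticUsl2 hbar →A[ℂ] (V →L[ℂ] V)) {W : Submodule ℂ V}
    (hW : IsClosed (W : Set V)) (hgen : ∀ g, ∀ w ∈ W, T (gen hbar g) w ∈ W)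
    (a : AnalyticUsl2 hbar) : ∀ w ∈ W, T a w ∈ W := by
  let S : Subalgebra ℂ (V →L[ℂ] V) :=
    { carrier := {X | ∀ w ∈ W, X w ∈ W}
      mul_mem' := fun hX hY w hw => hX _ (hY w hw)
      add_mem' := fun hX hY w hw => W.add_mem (hX w hw) (hY w hw)
      algebraMap_mem' := fun r w hw => by
        simpa [Algebra.algebraMap_eq_smul_one] using W.smul_mem r hw }
  have hS : IsClosed (S : Set (V →L[ℂ] V)) := by
    have : (S : Set (V →L[ℂ] V)) =
        ⋂ w ∈ W, (ContinuousLinearMap.apply ℂ V w) ⁻¹' (W : Set V) := by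
      ext X; simp only [Set.mem_iInter]; rfl
    rw [this]
    exact isClosed_biInter fun w _ => hW.preimage (ContinuousLinearMap.apply ℂ V w).continuous
  exact map_mem_of_gen_mem T S hS hgen a

/-- Schur's lemma: an operator commuting with an irreducible representation is scalar. -/
theorem IsIrreducible.exists_eq_smul_one [CompleteSpace V]
    {T : AnalyticUsl2 hbar →A[ℂ] (V →L[ℂ] V)} (hT : IsIrreducible T) {C : V →L[ℂ] V}
    (hC : ∀ a, Commute C (T a)) : ∃ c : ℂ, C = c • (1 : V →L[ℂ] V) := by
  have := hT.1
  obtain ⟨c, hc⟩ := spectrum.nonempty C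
  refine ⟨c, ?_⟩
  set D : V →L[ℂ] V := algebraMap ℂ (V →L[ℂ] V) c - C with hD
  have hDT (a) (v : V) : D (T a v) = T a (D v) :=
    have h1 : Commute (algebraMap ℂ (V →L[ℂ] V) c) (T a) := Algebra.commutes c (T a)
    DFunLike.congr_fun (h1.sub_left (hC a)).eq v
  suffices h0 : D = 0 by rw [← Algebra.algebraMap_eq_smul_one, sub_eq_zero.1 h0]
  by_contra hD0
  have hker : D.ker = ⊥ := by
    refine (hT.2 D.ker fun a v hv => ?_).resolve_right fun htop => hD0 ?_
    · change D (T a v) = 0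
      rw [hDT, show D v = 0 from hv, map_zero]
    · ext v
      exact (htop ▸ Submodule.mem_top : v ∈ D.ker)
  -- The range is not known to be closed; this uses irreducibility with respect to arbitrary linear
  -- subspaces.
  have hran : D.range = ⊤ := by
    refine (hT.2 D.range ?_).resolve_left fun hbot => hD0 ?_
    · rintro a _ ⟨v, rfl⟩
      exact ⟨T a v, hDT a v⟩
    · ext v
      have : D v ∈ D.range := ⟨v, rfl⟩
      rwa [hbot] at this
  -- By the open mapping theorem the bijection `D` is invertible, although `c` lies in the spectrum
  -- of `C`.
  exact hc (ContinuousLinearMap.isUnit_iff_bijective.2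
    ⟨LinearMap.ker_eq_bot.1 hker, LinearMap.range_eq_top.1 hran⟩)

end AnalyticUsl2

theorem theorem2p2 (hbar : ℂ) (hsinh : Complex.sinh hbar ≠ 0) {V : Type*} [NormedAddCommGroup V]
    [NormedSpace ℂ V] [CompleteSpace V] (T : AnalyticUsl2 hbar →A[ℂ] (V →L[ℂ] V))
    (hT : AnalyticUsl2.IsIrreducible T) : FiniteDimensional ℂ V := by
  have := hT.1
  have h := AnalyticUsl2.relations_map T
  obtain ⟨hCE, hCF, hCH⟩ := h.commute_casimir hsinh rfl
  obtain ⟨c, hc⟩ := hT.exists_eq_smul_one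
    (AnalyticUsl2.commute_map_of_gen T fun g => by cases g <;> assumption)
  obtain ⟨v, hv, hEv, μ, hμ⟩ := h.exists_highestWeight hsinh hc
  obtain ⟨W, hvW, hfin, hE, hF, hH⟩ := h.exists_invariant_finiteDimensional hEv hμ
  have hW : W = ⊤ := by
    refine (hT.2 W (AnalyticUsl2.map_mem_of_gen_invariant T W.closed_of_finiteDimensional
      fun g => ?_)).resolve_left fun hbot => hv ?_
    · cases g <;> assumption
    · rwa [hbot, Submodule.mem_bot] at hvW
  rw [hW] at hfin
  exact Module.Finite.equiv Submodule.topEquiv
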